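/- Let $k\ge 1$, $[k]=\{1,\dots,k\}$, and let $[k]^\omega=\bigcup_{n\ge1}[k]^n$ be the set of nonempty finite words over $[k]$. A variable word $b$ is a finite word over $[k]\cup\{*\}$ in which $*$ occurs at least once; $b(a)\in[k]^\omega$ denotes the result of replacing every $*$ by $a\in[k]$. A combinatorial line is a map $\ell:[k]\to[k]^\omega$, $\ell(a)=b(a)$, for some variable word $b$. A subspace is a map $\phi:[k]^\omega\to[k]^\omega$ of the form $\phi(v_1v_2\cdots v_n)=b_1(v_1)b_2(v_2)\cdots b_n(v_n)$ (concatenation) for some sequence $b_1,b_2,\dots$ of variable words. A law on a standard Borel space $(X,\Sigma)$ is a probability measure $\mu$ on $(X^{[k]^\omega},\Sigma^{\otimes[k]^\omega})$. It is strongly stationary if for every subspace $\phi$ the image of $\mu$ under $(x_w)_w\mapsto(x_{\phi(w)})_w$ is $\mu$. In that case the distribution $\mu^\circ$ on $X$ of $x_w$ under $\mu$ is the same for all $w\in[k]^\omega$ (the point-marginal), and the distribution $\mu^{\mathrm{line}}$ on $X^k$ of $(x_{\ell(1)},\dots,x_{\ell(k)})$ under $\mu$ is the same for all combinatorial lines $\ell$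 (the line-marginal). For nonempty $e\subseteq[k]$ let $\Phi_e\le\Sigma$ be the $\sigma$-algebra of those $A\in\Sigma$ such that, for every combinatorial line $\ell$ and $\mu$-almost every $(x_w)_w$, one has $1_A(x_{\ell(i)})=1_A(x_{\ell(j)})$ for all $i,j\in e$. For a family $\mathcal I$ of subsets of $[k]$ let $\Phi_{\mathcal I}=\bigvee_{e\in\mathcal I}\Phi_e$; call $\mathcal I$ an up-set if all its members have at least two elements and $u\in\mathcal I$, $u\subseteq v\subseteq[k]$ imply $v\in\mathcal I$. A strongly stationary extension of $\mu$ is a strongly stationary law $\tilde\mu$ on a standard Borel space $\tilde X$ together with a measurable map $\pi:\tilde X\to X$ such that the image of $\tilde\mu$ under $(\tilde x_w)_w\mapsto(\pi(\tilde x_w))_w$ is $\mu$; write $\tilde\Phi_{\mathcal I}$ for the corresponding $\sigma$-algebras of $\tilde\mu$. The strongly stationary law $\mu$ is fully sated if, for every nonempty up-set $\mathcal I$ and every strongly stationary extension $(\tilde\mu,\pi)$ of $\mu$, the $\sigma$-algebras $\pi^{-1}(\Sigma)$ and $\tilde\Phi_{\mathcal I}$ are conditionally independent given $\pi^{-1}(\Phi_{\mathcal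 I})$ under $\tilde\mu^\circ$. **Theorem.** Let $\mu$ be a fully sated strongly stationary law on a standard Borel space $(X,\Sigma)$, let $e\subseteq[k]$ be nonempty, and for each $i\in e$ let $f_i\in L^\infty(\mu^\circ)$ (real- or complex-valued). Then $$\int_{X^k}\prod_{i\in e}f_i\circ\pi_i\,d\mu^{\mathrm{line}}=\int_{X^k}\prod_{i\in e}\mathsf E_{\mu^\circ}\Big(f_i\,\Big|\,\bigvee_{l\in e\setminus\{i\}}\Phi_{\{i,l\}}\Big)\circ\pi_i\,d\mu^{\mathrm{line}},$$ where $\pi_i:X^k\to X$ is the $i$-th coordinate projection and the empty join is the trivial $\sigma$-algebra. -/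

import Mathlib

open MeasureTheory ProbabilityTheory

universe u

namespace CombLaw

/-- The infinite-dimensional combinatorial space over the alphabet `Fin k`: all nonempty finite
words. -/
abbrev Word (k : ℕ) : Type := {w : List (Fin k) // w ≠ []}

/-- A variable word: a finite word over `Fin k` together with a variable (`none`) that occurs
at least once. -/
abbrev VarWord (k : ℕ) : Type := {b : List (Option (Fin k)) // none ∈ b}

/-- Replace every occurrence of the variable by the letter `a`. -/
def VarWord.subst {k : ℕ} (b : VarWord k) (a : Fin k) : List (Fin k) :=
  b.1.map (fun c => c.getD a)

theorem VarWord.subst_ne_nil {k : ℕ} (b : VarWord k) (a : Fin k) : b.subst a ≠ [] := by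
  intro h
  have h0 : b.1 = [] := List.map_eq_nil_iff.1 h
  have h1 := b.2
  rw [h0] at h1
  exact List.not_mem_nil h1

/-- The combinatorial line `i ↦ b(i)` determined by a variable word `b`. -/
def line {k : ℕ} (b : VarWord k) (i : Fin k) : Word k := ⟨b.subst i, b.subst_ne_nil i⟩

/-- The concatenation `B₀(v₀) B₁(v₁) ⋯ Bₙ(vₙ)`. -/
def substList {k : ℕ} : (ℕ → VarWord k) → List (Fin k) → List (Fin k)
  | _, [] => []
  | B, a :: v => (B 0).subst a ++ substList (fun n => B (n + 1)) v

theorem substList_ne_nil {k : ℕ} (B : ℕ → VarWord k) {v : List (Fin k)} (hv : v ≠ []) :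
    substList B v ≠ [] := by
  cases v with
  | nil => exact absurd rfl hv
  | cons a v =>
    intro h
    exact (B 0).subst_ne_nil a (List.append_eq_nil_iff.1 h).1

/-- The infinite-dimensional subspace, as a self-map of the space of words, determined by a
sequence `B` of variable words: the block `B n` carries the letters in the positions
`N_n < m ≤ N_{n+1}`, its variable occupies the nonempty set of positions `I_{n+1}`, and the other
positions hold the fixed letters. -/
def subspace {k : ℕ} (B : ℕ → VarWord k) (v : Word k) : Word k :=
  ⟨substList B v.1, substList_ne_nil B v.2⟩

/-- The one-letter word `i`. -/
def letter {k : ℕ} (i : Fin k) : Word k := ⟨[i], List.cons_ne_nil i []⟩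

section Laws

variable {k : ℕ} {X : Type u} [MeasurableSpace X]

/-- The law of `(x_{φ(w)})_w` is that of `(x_w)_w`, for every infinite-dimensional
subspace `φ`. -/
def StronglyStationary (μ : Measure (Word k → X)) : Prop :=
  ∀ B : ℕ → VarWord k, μ.map (fun x w => x (subspace B w)) = μ

/-- The point-marginal: the law of a single coordinate. It is read off at a one-letter word; under
strong stationarity every word gives the same measure (`map_eval_eq_pointMarginal`). -/
noncomputable def pointMarginal [NeZero k] (μ : Measure (Word k → X)) : Measure X :=
  μ.map (fun x => x (letter 0))

/-- The line-marginal: the joint law of `(x_{ℓ(i)})_i` along a combinatorial line `ℓ`. It is read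
off at the line of one-letter words; under strong stationarity every line gives the same measure
(`map_line_eq_lineMarginal`). -/
noncomputable def lineMarginal (μ : Measure (Word k → X)) : Measure (Fin k → X) :=
  μ.map (fun x i => x (letter i))

instance [NeZero k] (μ : Measure (Word k → X)) [IsProbabilityMeasure μ] :
    IsProbabilityMeasure (pointMarginal μ) :=
  Measure.isProbabilityMeasure_map (measurable_pi_apply _).aemeasurable

instance (μ : Measure (Word k → X)) [IsProbabilityMeasure μ] :
    IsProbabilityMeasure (lineMarginal μ) :=
  Measure.isProbabilityMeasure_map
    (measurable_pi_lambda _ fun _ => measurable_pi_apply _).aemeasurable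

theorem subspace_letter (b : VarWord k) (i : Fin k) :
    subspace (fun _ => b) (letter i) = line b i :=
  Subtype.ext (List.append_nil _)

theorem measurable_reindex {ι κ : Type*} (g : κ → ι) :
    Measurable (fun (x : ι → X) (j : κ) => x (g j)) :=
  measurable_pi_lambda _ fun j => measurable_pi_apply (g j)

theorem map_line_eq_lineMarginal {μ : Measure (Word k → X)} (hμ : StronglyStationary μ)
    (b : VarWord k) : μ.map (fun x i => x (line b i)) = lineMarginal μ := by
  have h := congrArg (fun ν => ν.map (fun (x : Word k → X) (i : Fin k) => x (letter i)))
    (hμ (fun _ => b))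
  have h2 := Measure.map_map (μ := μ) (measurable_reindex (X := X) (letter (k := k)))
    (measurable_reindex (subspace (fun _ => b)))
  have h3 := h2.symm.trans h
  simp only [Function.comp_def, subspace_letter] at h3
  exact h3

theorem map_line_apply {μ : Measure (Word k → X)} (hμ : StronglyStationary μ)
    (b : VarWord k) (i : Fin k) :
    μ.map (fun x => x (line b i)) = μ.map (fun x => x (letter i)) := by
  have h := congrArg (fun ν => ν.map (fun y : Fin k → X => y i)) (map_line_eq_lineMarginal hμ b)
  have h1 := Measure.map_map (μ := μ) (measurable_pi_apply (X := fun _ : Fin k => X) i)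
    (measurable_reindex (line b))
  have h2 := Measure.map_map (μ := μ) (measurable_pi_apply (X := fun _ : Fin k => X) i)
    (measurable_reindex (letter (k := k)))
  exact h1.symm.trans (h.trans h2)

theorem map_eval_eq_pointMarginal [NeZero k] {μ : Measure (Word k → X)}
    (hμ : StronglyStationary μ) (w : Word k) :
    μ.map (fun x => x w) = pointMarginal μ := by
  obtain ⟨w, hw⟩ := w
  cases w with
  | nil => exact absurd rfl hw
  | cons a v =>
    have h1 : (⟨a :: v, hw⟩ : Word k)
        = line ⟨none :: v.map some, List.mem_cons_self⟩ a := by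
      apply Subtype.ext
      simp [line, VarWord.subst, Function.comp_def]
    have h2 : line (⟨[none, some (0 : Fin k)], by simp⟩ : VarWord k) a
        = line (⟨[some a, none], by simp⟩ : VarWord k) 0 := by
      apply Subtype.ext
      simp [line, VarWord.subst]
    rw [h1, map_line_apply hμ, ← map_line_apply hμ ⟨[none, some (0 : Fin k)], by simp⟩ a, h2,
      map_line_apply hμ]
    rfl

/-- The σ-algebra `Φ_e` of `e`-insensitive sets: the measurable `A` such that, almost surely, the
truth value of `x_{ℓ(i)} ∈ A` does not depend on `i ∈ e`, for every combinatorial line `ℓ`. -/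
@[reducible] def insens (μ : Measure (Word k → X)) (e : Finset (Fin k)) : MeasurableSpace X where
  MeasurableSet' A := MeasurableSet A ∧
    ∀ b : VarWord k, ∀ᵐ x ∂μ, ∀ i ∈ e, ∀ j ∈ e, (x (line b i) ∈ A ↔ x (line b j) ∈ A)
  measurableSet_empty := ⟨MeasurableSet.empty, fun _ => by simp⟩
  measurableSet_compl A hA := ⟨hA.1.compl, fun b => by
    filter_upwards [hA.2 b] with x hx i hi j hj
    exact not_congr (hx i hi j hj)⟩
  measurableSet_iUnion A hA := ⟨MeasurableSet.iUnion fun n => (hA n).1, fun b => by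
    filter_upwards [ae_all_iff.2 fun n => (hA n).2 b] with x hx i hi j hj
    simp only [Set.mem_iUnion]
    exact exists_congr fun n => hx n i hi j hj⟩

/-- `Φ_I`, the join of the `Φ_e` over the members `e` of the family `I`. -/
@[reducible] def insensJoin (μ : Measure (Word k → X)) (I : Set (Finset (Fin k))) : MeasurableSpace X :=
  ⨆ e ∈ I, insens μ e

theorem insens_le (μ : Measure (Word k → X)) (e : Finset (Fin k)) :
    insens μ e ≤ (inferInstance : MeasurableSpace X) := fun _ hA => hA.1

theorem insensJoin_le (μ : Measure (Word k → X)) (I : Set (Finset (Fin k))) :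
    insensJoin μ I ≤ (inferInstance : MeasurableSpace X) :=
  iSup₂_le fun e _ => insens_le μ e

/-- Up-sets in the family of subsets of the alphabet having at least two elements. -/
structure IsUpSet (I : Set (Finset (Fin k))) : Prop where
  two_le_card : ∀ e ∈ I, 2 ≤ e.card
  mem_of_subset : ∀ e ∈ I, ∀ e' : Finset (Fin k), e ⊆ e' → e' ∈ I

end Laws

section Sated

variable {k : ℕ} [NeZero k] {X : Type u} [mX : MeasurableSpace X]

/-- `μ` is `I`-sated: for every strongly stationary extension `μ'` of `μ`, through a factor map
`π`, the factor `π` and `Φ'_I` are relatively independent over `π⁻¹(Φ_I)` under the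
point-marginal of `μ'`. (Every standard Borel space is isomorphic to one in the universe of `X`.) -/
def Sated (I : Set (Finset (Fin k))) (μ : Measure (Word k → X)) : Prop :=
  ∀ (X' : Type u) [MeasurableSpace X'] [StandardBorelSpace X']
    (μ' : Measure (Word k → X')) [IsProbabilityMeasure μ'],
    StronglyStationary μ' →
    ∀ (π : X' → X) (hπ : Measurable π), μ'.map (fun x w => π (x w)) = μ →
      CondIndep ((insensJoin μ I).comap π) (mX.comap π) (insensJoin μ' I)
        ((MeasurableSpace.comap_mono (insensJoin_le μ I)).trans hπ.comap_le)
        (pointMarginal μ')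

/-- `μ` is fully sated: it is `I`-sated for every nonempty up-set `I`. -/
def FullySated (μ : Measure (Word k → X)) : Prop :=
  ∀ I : Set (Finset (Fin k)), IsUpSet I → I.Nonempty → Sated I μ

end Sated

end CombLaw

/-!
One factor is replaced at a time. Fix a letter `i₀ ∈ e` and suppose that `μ` has a strongly
stationary extension `μ'` on `X^k`, with the `i₀`-th coordinate as factor map, such that

* the point-marginal of `μ'` is the line-marginal of `μ`, and
* the `l`-th coordinate of `X^k` is `{i₀, l}`-insensitive under `μ'`, for every `l`.

Under this point-marginal the product of the `f_l(y_l)` over `l ∈ e \ {i₀}` is measurable for the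
join of the σ-algebras `Φ'_u`, where `u` ranges over the up-set generated by the pairs `{i₀, l}`, and
`f_{i₀}(y_{i₀})` is measurable for the factor. Satedness makes the two relatively independent over
the corresponding join for `μ`, which is the join of the `Φ_{i₀,l}`. Hence `f_{i₀}` may be replaced
by its conditional expectation (`CombLaw.integral_prod_eq_condExp_mul`).

For the extension (`CombLaw.exists_insensitive_extension`) let `r_l` replace every letter `i₀` by
`l`, and consider the process `x'_w = (x_{l · r_l(w)})_l` for `x` of law `μ`. The points in `x'_w` lie
along a combinatorial line, and its `l`-th coordinate is the same at `ℓ(i₀)` and `ℓ(l)` for every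
line `ℓ`. The process `x'` need not be strongly stationary. Both properties persist when `x'` is
restricted to a subspace and under weak limits, so it is enough to find a limit of restrictions to
random subspaces that is strongly stationary.

Draw the blocks of the subspace independently, in the sense of iterated limits, from an ultrafilter
`p` on the semigroup of words over the alphabet with a variable. The limit law is strongly stationary
if `p(c₁) ⋯ p(cᵣ) = p` whenever at least one `cᵢ` is the variable; here `p(c)` is the image of `p`
under the substitution of `c` for the variable. This holds when `p` is idempotent, the `p(a)` for
letters `a` all equal the same idempotent `q`, and `p q = q p = p`. Such a pair is obtained by taking
`q` in a minimal left ideal of the compact semigroup of ultrafilters on words without variable, and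
`p ≤ q` an idempotent in the ideal of ultrafilters concentrated on variable words
(`CombLaw.exists_idempotent_ultrafilters`). Weak limits exist because `X` embeds measurably into the
Cantor space and the probability measures on a compact metrizable space are compact.
-/

namespace CombLaw

open Filter Topology

/-! ### Idempotent ultrafilters of variable words -/

/-- A compact right topological semigroup contains a closed minimal left ideal `L`; minimality is
expressed by `L` being generated by each of its elements. -/
theorem exists_minimal_closed_leftIdeal {M : Type*} [Semigroup M] [TopologicalSpace M]
    [CompactSpace M] [T2Space M] [Nonempty M] (hc : ∀ r : M, Continuous (· * r)) :
    ∃ L : Set M, IsClosed L ∧ L.Nonempty ∧ (∀ m, ∀ x ∈ L, m * x ∈ L) ∧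
      ∀ x ∈ L, ∀ y ∈ L, ∃ t, t * x = y := by
  let S : Set (Set M) := {N | IsClosed N ∧ N.Nonempty ∧ ∀ m, ∀ x ∈ N, m * x ∈ N}
  obtain ⟨L, hL⟩ : ∃ L, Minimal (· ∈ S) L := by
    refine zorn_superset _ fun c hcs hch => ⟨⋂₀ c, ⟨isClosed_sInter fun t ht => (hcs ht).1, ?_,
      fun m x hx t ht => (hcs ht).2.2 m x (hx t ht)⟩, fun s hs => Set.sInter_subset_of_mem hs⟩
    obtain rfl | hcne := c.eq_empty_or_nonempty
    · rw [Set.sInter_empty]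
      exact Set.univ_nonempty
    · have := hcne.coe_sort
      rw [Set.sInter_eq_iInter]
      exact IsCompact.nonempty_iInter_of_directed_nonempty_isCompact_isClosed _
        (DirectedOn.directed_val (IsChain.directedOn hch.symm))
        (fun i => (hcs i.2).2.1) (fun i => (hcs i.2).1.isCompact) (fun i => (hcs i.2).1)
  refine ⟨L, hL.prop.1, hL.prop.2.1, hL.prop.2.2, fun x hx y hy => ?_⟩
  have h : Set.range (· * x) = L := by
    refine hL.eq_of_subset ⟨(isCompact_range (hc x)).isClosed, ⟨_, x, rfl⟩, ?_⟩ ?_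
    · rintro m _ ⟨z, rfl⟩
      exact ⟨m * z, mul_assoc _ _ _⟩
    · rintro _ ⟨z, rfl⟩
      exact hL.prop.2.2 z x hx
  rw [← h] at hy
  exact hy

attribute [local instance] Ultrafilter.semigroup

theorem ultrafilter_map_mul {S W : Type*} [Semigroup S] [Semigroup W] (σ : S →ₙ* W)
    (U V : Ultrafilter S) : (U * V).map σ = U.map σ * V.map σ := by
  refine Ultrafilter.coe_inj.mp (Filter.ext' fun P => ?_)
  rw [Ultrafilter.eventually_mul]
  simp only [Ultrafilter.coe_map, Filter.eventually_map]
  rw [Ultrafilter.eventually_mul]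
  simp only [map_mul]

/-- Let `W` be a subsemigroup of `S`, `J` a two-sided ideal of `S` and `σ a : S → W` retractions.
There are idempotent ultrafilters `q` on `W` and `p ≤ q` on `S`, with `p` concentrated on `J`,
such that every `σ a` maps `p` to `q`. Any minimal idempotent of `βW` can serve as `q`. -/
theorem exists_idempotent_ultrafilters {S W A : Type*} [Semigroup S] [Semigroup W] [Nonempty W]
    (j : W →ₙ* S) (J : Set S) (hJ : J.Nonempty) (hl : ∀ s, ∀ t ∈ J, s * t ∈ J)
    (hr : ∀ s ∈ J, ∀ t, s * t ∈ J) (σ : A → S →ₙ* W) (hσ : ∀ a w, σ a (j w) = w) :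
    ∃ (p : Ultrafilter S) (q : Ultrafilter W), J ∈ p ∧ p * p = p ∧ q * q = q ∧
      p * q.map j = p ∧ q.map j * p = p ∧ ∀ a, p.map (σ a) = q := by
  obtain ⟨L, hLc, hLne, hLl, hLmin⟩ :=
    exists_minimal_closed_leftIdeal (Ultrafilter.continuous_mul_left (M := W))
  obtain ⟨q, hqL, hq⟩ := exists_idempotent_in_compact_subsemigroup
    (Ultrafilter.continuous_mul_left (M := W)) L hLne hLc.isCompact (fun x _ y hy => hLl x y hy)
  set q' : Ultrafilter S := q.map j with hq'
  have hqq' : q' * q' = q' := by rw [hq', ← ultrafilter_map_mul, hq]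
  let K : Set (Ultrafilter S) := {U | J ∈ U}
  have hKc : IsClosed K := ultrafilter_isClosed_basic J
  have hKl : ∀ U, ∀ V ∈ K, U * V ∈ K := fun U V hV =>
    (Ultrafilter.eventually_mul U V (· ∈ J)).2
      (Eventually.of_forall fun s => Filter.mem_of_superset hV fun t ht => hl s t ht)
  have hKr : ∀ U ∈ K, ∀ V, U * V ∈ K := fun U hU V =>
    (Ultrafilter.eventually_mul U V (· ∈ J)).2
      (Filter.mem_of_superset hU fun s hs => Eventually.of_forall fun t => hr s hs t)
  obtain ⟨p₀, ⟨i, hi, rfl⟩, hp₀⟩ := exists_idempotent_in_compact_subsemigroup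
    (Ultrafilter.continuous_mul_left (M := S)) ((· * q') '' K)
    (by
      obtain ⟨s, hs⟩ := hJ
      exact ⟨_, pure s, hs, rfl⟩)
    (hKc.isCompact.image (Ultrafilter.continuous_mul_left q'))
    (by
      rintro _ ⟨x, hx, rfl⟩ _ ⟨y, hy, rfl⟩
      exact ⟨x * q' * y, hKl _ _ hy, by simp only [mul_assoc]⟩)
  simp only at hp₀
  have hpq : i * q' * q' = i * q' := by rw [mul_assoc, hqq']
  -- `i * q'` need not commute with `q'`; multiplying by `q'` on the left repairs this.
  refine ⟨q' * (i * q'), q, hKl q' _ (hKr i hi q'), ?_, hq, ?_, ?_, fun a => ?_⟩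
  · rw [mul_assoc, ← mul_assoc (i * q') q', hpq, hp₀]
  · rw [mul_assoc, hpq]
  · rw [← mul_assoc, hqq']
  · have hjq : q'.map (σ a) = q := by
      rw [hq', Ultrafilter.map_map]
      convert Ultrafilter.map_id q
      exact funext (hσ a)
    set r := (i * q').map (σ a) with hrdef
    have hrL : r ∈ L := by
      rw [hrdef, ultrafilter_map_mul, hjq]
      exact hLl _ _ hqL
    have hrr : r * r = r := by rw [hrdef, ← ultrafilter_map_mul, hp₀]
    -- The image of `p` is `q * r`, which equals `t * r * r = t * r = q` as `q = t * r`.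
    obtain ⟨t, ht⟩ := hLmin r hrL q hqL
    rw [ultrafilter_map_mul, hjq, ← hrdef]
    conv_lhs => rw [← ht, mul_assoc, hrr]
    exact ht

/-- The result `b(c)` of replacing every variable `none` of `b` by `c`; for `c = none` this
is `b` itself. -/
def fill {α : Type*} (b : List (Option α)) (c : Option α) : List (Option α) :=
  b.map fun o => o.orElse fun _ => c

theorem fill_none {α : Type*} (b : List (Option α)) : fill b none = b := by
  rw [fill]
  convert List.map_id b using 2
  funext o
  cases o <;> rfl

theorem fill_some {α : Type*} (b : List (Option α)) (a : α) :
    fill b (some a) = (b.map fun o => o.getD a).map some := by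
  rw [fill, List.map_map]
  congr 1
  funext o
  cases o <;> rfl

/-- `IterEventually p L R` says that `R (b₁(c₁) b₂(c₂) ⋯ bᵣ(cᵣ))` holds for `p`-almost all `b₁`,
for `p`-almost all `b₂`, and so on, where `L = [c₁, …, cᵣ]`. -/
def IterEventually {α : Type*} (p : Ultrafilter (List (Option α))) :
    List (Option α) → (List (Option α) → Prop) → Prop
  | [], R => R []
  | c :: L, R => ∀ᶠ b in (p : Filter (List (Option α))),
      IterEventually p L fun s => R (fill b c ++ s)

/-- There is an ultrafilter `p` of variable words which is invariant under the formation of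
variable words `b₁(c₁) ⋯ bᵣ(cᵣ)` from independent `p`-random variable words `b₁, …, bᵣ`. -/
theorem exists_invariant_ultrafilter (α : Type*) :
    ∃ p : Ultrafilter (List (Option α)), (∀ᶠ b in (p : Filter (List (Option α))), none ∈ b) ∧
      ∀ L : List (Option α), none ∈ L → ∀ R, IterEventually p L R ↔
        ∀ᶠ b in (p : Filter (List (Option α))), R b := by
  let j : FreeMonoid α →ₙ* FreeMonoid (Option α) := (FreeMonoid.map some).toMulHom
  let σ : α → FreeMonoid (Option α) →ₙ* FreeMonoid α :=
    fun a => (FreeMonoid.map fun o : Option α => o.getD a).toMulHom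
  obtain ⟨p, q, hJ, hp, hq, hpq, hqp, hσ⟩ := exists_idempotent_ultrafilters j
    {b | none ∈ FreeMonoid.toList b} ⟨FreeMonoid.of none, by simp⟩
    (fun s t ht => by
      simp only [Set.mem_ofPred_eq, FreeMonoid.toList_mul, List.mem_append] at ht ⊢
      exact Or.inr ht)
    (fun s hs t => by
      simp only [Set.mem_ofPred_eq, FreeMonoid.toList_mul, List.mem_append] at hs ⊢
      exact Or.inl hs)
    σ (fun a w => by
      change FreeMonoid.map _ (FreeMonoid.map _ w) = w
      rw [FreeMonoid.map_map]
      exact List.map_id w)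
  -- `P c` is the law of `b(c)` for a `p`-random `b`, and `Q L` that of `b₁(c₁) ⋯ bᵣ(cᵣ)`.
  let P : Option α → Ultrafilter (FreeMonoid (Option α)) :=
    fun c => p.map fun b => FreeMonoid.ofList (fill (FreeMonoid.toList b) c)
  let Q : List (Option α) → Ultrafilter (FreeMonoid (Option α)) :=
    fun L => L.foldr (fun c U => P c * U) (pure 1)
  have hPnone : P none = p := by
    have h : (fun b => FreeMonoid.ofList (fill (FreeMonoid.toList b) none)) =
        (id : FreeMonoid (Option α) → _) := funext fun b => fill_none b
    change p.map (fun b => FreeMonoid.ofList (fill (FreeMonoid.toList b) none)) = p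
    rw [h, Ultrafilter.map_id]
  have hPsome : ∀ a, P (some a) = q.map j := by
    intro a
    rw [← hσ a, Ultrafilter.map_map]
    change p.map _ = p.map _
    congr 1
    exact funext fun b => fill_some b a
  have hQ : ∀ L R, IterEventually p L R ↔ ∀ᶠ b in (Q L : Filter (FreeMonoid (Option α))), R b := by
    intro L
    induction L with
    | nil => intro R; exact Iff.rfl
    | cons c L ih =>
      intro R
      refine Iff.trans ?_ (Ultrafilter.eventually_mul (P c) (Q L) R).symm
      simp only [IterEventually, ih]
      exact Iff.rfl
  have hjj : q.map j * q.map j = q.map j := by rw [← ultrafilter_map_mul, hq]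
  have hmul_one : ∀ U : Ultrafilter (FreeMonoid (Option α)), U * pure 1 = U := by
    intro U
    refine Ultrafilter.coe_inj.mp (Filter.ext' fun R => ?_)
    rw [Ultrafilter.eventually_mul]
    simp
  have key : ∀ L : List (Option α), (none ∈ L → Q L = p) ∧
      (none ∉ L → L ≠ [] → Q L = q.map j) := by
    intro L
    induction L with
    | nil => simp
    | cons c L ih =>
      have hcons : Q (c :: L) = P c * Q L := rfl
      rcases eq_or_ne L [] with rfl | hL
      · have h1 : Q [] = pure 1 := rfl
        rw [hcons, h1, hmul_one]
        cases c with
        | none => simp [hPnone]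
        | some a => simp [hPsome]
      · by_cases hn : none ∈ L
        · rw [hcons, ih.1 hn]
          cases c with
          | none => simp [hPnone, hp]
          | some a => simp [hPsome, hqp, hn]
        · rw [hcons, ih.2 hn hL]
          cases c with
          | none => simp [hPnone, hpq]
          | some a => simp [hPsome, hjj, hn]
  exact ⟨p, hJ, fun L hL R => by rw [hQ, (key L).1 hL]⟩

/-! ### Composition of subspaces and random sequences of variable words -/

/-- The concatenation `B₀(c₀) B₁(c₁) ⋯ Bₙ(cₙ)`, where a letter `none` of the argument keeps the
variable. -/
def fillSeq {α : Type*} : (ℕ → List (Option α)) → List (Option α) → List (Option α)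
  | _, [] => []
  | B, c :: L => fill (B 0) c ++ fillSeq (fun n => B (n + 1)) L

/-- The concatenation `B₀(v₀) B₁(v₁) ⋯ Bₙ(vₙ)` for words `v` without variable. Unlike in
`substList`, the blocks `Bᵢ` are not required to contain the variable. -/
def substSeq {α : Type*} : (ℕ → List (Option α)) → List α → List α
  | _, [] => []
  | B, a :: v => ((B 0).map fun o => o.getD a) ++ substSeq (fun n => B (n + 1)) v

/-- The sequence of blocks of the composite of the subspaces with blocks `B` and `C`. -/
def compSeq {α : Type*} (B C : ℕ → List (Option α)) : ℕ → List (Option α)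
  | 0 => fillSeq B (C 0)
  | n + 1 => compSeq (fun i => B (i + (C 0).length)) (fun i => C (i + 1)) n

theorem substList_eq_substSeq {k : ℕ} (B : ℕ → VarWord k) (v : List (Fin k)) :
    substList B v = substSeq (fun n => (B n).1) v := by
  induction v generalizing B with
  | nil => rfl
  | cons a v ih => simp only [substList, substSeq, ih, VarWord.subst]

theorem substSeq_append {α : Type*} (B : ℕ → List (Option α)) (u v : List α) :
    substSeq B (u ++ v) = substSeq B u ++ substSeq (fun i => B (i + u.length)) v := by
  induction u generalizing B with
  | nil => simp [substSeq]
  | cons a u ih => simp [substSeq, ih, add_assoc]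

theorem substSeq_map_getD {α : Type*} (B : ℕ → List (Option α)) (L : List (Option α)) (a : α) :
    substSeq B (L.map fun o => o.getD a) = (fillSeq B L).map fun o => o.getD a := by
  induction L generalizing B with
  | nil => rfl
  | cons c L ih =>
    simp only [List.map_cons, substSeq, fillSeq, List.map_append, ih, fill, List.map_map]
    congr 1
    refine List.map_congr_left fun o _ => ?_
    cases o <;> rfl

theorem substSeq_compSeq {α : Type*} (B C : ℕ → List (Option α)) (v : List α) :
    substSeq (compSeq B C) v = substSeq B (substSeq C v) := by
  induction v generalizing B C with
  | nil => rfl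
  | cons a v ih =>
    have h := ih (fun i => B (i + (C 0).length)) (fun i => C (i + 1))
    simp only [substSeq, substSeq_append, substSeq_map_getD, List.length_map]
    rw [← h]
    rfl

theorem substSeq_congr {α : Type*} {B B' : ℕ → List (Option α)} {v : List α}
    (h : ∀ i < v.length, B i = B' i) : substSeq B v = substSeq B' v := by
  induction v generalizing B B' with
  | nil => rfl
  | cons a v ih =>
    simp only [substSeq]
    rw [h 0 (by simp), ih fun i hi => h (i + 1) (by simpa using hi)]

/-- The sequence `b, B₀, B₁, …`. -/
def consSeq {β : Type*} (b : β) (B : ℕ → β) : ℕ → β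
  | 0 => b
  | n + 1 => B n

/-- The law of a sequence whose first `n` terms are independent and `p`-random, where independence
is understood in the sense of iterated limits (`∀ᶠ B₀, ∀ᶠ B₁, …`), and whose other terms equal
`d`. -/
noncomputable def seqUltrafilter {β : Type*} (p : Ultrafilter β) (d : β) : ℕ → Ultrafilter (ℕ → β)
  | 0 => pure fun _ => d
  | n + 1 => p.bind fun b => (seqUltrafilter p d n).map (consSeq b)

theorem eventually_seqUltrafilter_succ {β : Type*} (p : Ultrafilter β) (d : β) (n : ℕ)
    (R : (ℕ → β) → Prop) :
    (∀ᶠ B in (seqUltrafilter p d (n + 1) : Filter (ℕ → β)), R B) ↔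
      ∀ᶠ b in (p : Filter β), ∀ᶠ B in (seqUltrafilter p d n : Filter (ℕ → β)), R (consSeq b B) :=
  Iff.rfl

theorem eventually_seqUltrafilter_forall {β : Type*} {p : Ultrafilter β} {d : β} {P : β → Prop}
    (hp : ∀ᶠ b in (p : Filter β), P b) (hd : P d) (n : ℕ) :
    ∀ᶠ B in (seqUltrafilter p d n : Filter (ℕ → β)), ∀ i, P (B i) := by
  induction n with
  | zero => exact fun _ => hd
  | succ n ih =>
    rw [eventually_seqUltrafilter_succ]
    filter_upwards [hp] with b hb
    filter_upwards [ih] with B hB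
    rintro (_ | i)
    · exact hb
    · exact hB i

theorem eventually_seqUltrafilter_of_le {β : Type*} (p : Ultrafilter β) (d : β) {m n : ℕ}
    (hmn : m ≤ n) {R : (ℕ → β) → Prop} (hR : DependsOn R (Set.Iio m)) :
    (∀ᶠ B in (seqUltrafilter p d n : Filter (ℕ → β)), R B) ↔
      ∀ᶠ B in (seqUltrafilter p d m : Filter (ℕ → β)), R B := by
  induction m generalizing n R with
  | zero =>
    have h : ∀ B, R B = R fun _ => d := fun B => hR (by simp)
    simp [h]
  | succ m ih =>
    obtain ⟨n, rfl⟩ : ∃ n', n = n' + 1 := ⟨n - 1, by omega⟩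
    simp only [eventually_seqUltrafilter_succ]
    refine eventually_congr (Eventually.of_forall fun b => ih (by omega) fun B B' h => hR ?_)
    rintro (_ | i) hi
    · rfl
    · exact h i (by simpa using hi)

theorem eventually_seqUltrafilter_fillSeq {α : Type*} (p : Ultrafilter (List (Option α)))
    (d : List (Option α)) (n : ℕ) (L : List (Option α))
    (R : List (Option α) → (ℕ → List (Option α)) → Prop) :
    (∀ᶠ B in (seqUltrafilter p d (n + L.length) : Filter (ℕ → List (Option α))),
      R (fillSeq B L) fun i => B (i + L.length)) ↔
    IterEventually p L fun s =>
      ∀ᶠ B in (seqUltrafilter p d n : Filter (ℕ → List (Option α))), R s B := by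
  induction L generalizing R with
  | nil => exact Iff.rfl
  | cons c L ih =>
    simp only [IterEventually, ← ih]
    exact Iff.rfl

/-- The first `m` terms of `compSeq B C` for random `B` have the same law as the first `m` terms
of `B`. -/
theorem eventually_seqUltrafilter_compSeq {α : Type*} {p : Ultrafilter (List (Option α))}
    (d : List (Option α))
    (hp : ∀ L : List (Option α), none ∈ L → ∀ R, IterEventually p L R ↔
        ∀ᶠ b in (p : Filter (List (Option α))), R b) (m : ℕ)
    {C : ℕ → List (Option α)} (hC : ∀ i, none ∈ C i) :
    ∃ N, ∀ n ≥ N, ∀ R : (ℕ → List (Option α)) → Prop, DependsOn R (Set.Iio m) →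
      ((∀ᶠ B in (seqUltrafilter p d n : Filter (ℕ → List (Option α))), R (compSeq B C)) ↔
        ∀ᶠ B in (seqUltrafilter p d m : Filter (ℕ → List (Option α))), R B) := by
  induction m generalizing C with
  | zero =>
    refine ⟨0, fun n _ R hR => ?_⟩
    have h : ∀ B, R B = R fun _ => d := fun B => hR (by simp)
    simp [h]
  | succ m ih =>
    obtain ⟨N, hN⟩ := ih fun i => hC (i + 1)
    refine ⟨N + (C 0).length, fun n hn R hR => ?_⟩
    obtain ⟨n, rfl⟩ : ∃ n', n = n' + (C 0).length := ⟨n - (C 0).length, by omega⟩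
    have hcomp : ∀ B, compSeq B C = consSeq (fillSeq B (C 0))
        (compSeq (fun i => B (i + (C 0).length)) fun i => C (i + 1)) := fun B => by
      funext i
      cases i <;> rfl
    simp only [hcomp]
    rw [eventually_seqUltrafilter_fillSeq p d n (C 0)
      fun s B => R (consSeq s (compSeq B fun i => C (i + 1))), hp _ (hC 0),
      eventually_seqUltrafilter_succ]
    refine eventually_congr (Eventually.of_forall fun b => hN n (by omega) _ fun B B' h => hR ?_)
    rintro (_ | i) hi
    · rfl
    · exact h i (by simpa using hi)

/-- There is an ultrafilter of sequences of variable words, whose finite-dimensional marginals are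
invariant under composition with a subspace on the inside. This is the substitute for a Ramsey
theorem of Carlson–Simpson type. -/
theorem exists_seqUltrafilter_invariant (α : Type*) :
    ∃ U : Ultrafilter (ℕ → List (Option α)),
      (∀ᶠ B in (U : Filter (ℕ → List (Option α))), ∀ i, none ∈ B i) ∧
      ∀ C : ℕ → List (Option α), (∀ i, none ∈ C i) → ∀ m, ∀ R : (ℕ → List (Option α)) → Prop,
        DependsOn R (Set.Iio m) →
        ((∀ᶠ B in (U : Filter (ℕ → List (Option α))), R (compSeq B C)) ↔
          ∀ᶠ B in (U : Filter (ℕ → List (Option α))), R B) := by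
  obtain ⟨p, hp, hinv⟩ := exists_invariant_ultrafilter α
  let d : List (Option α) := [none]
  let U := (hyperfilter ℕ).bind (seqUltrafilter p d)
  have hU : ∀ R : (ℕ → List (Option α)) → Prop,
      (∀ᶠ B in (U : Filter (ℕ → List (Option α))), R B) ↔ ∀ᶠ n in (hyperfilter ℕ : Filter ℕ),
        ∀ᶠ B in (seqUltrafilter p d n : Filter (ℕ → List (Option α))), R B := fun R => Iff.rfl
  have hlim : ∀ (P : ℕ → Prop) (c : Prop) (N : ℕ), (∀ n ≥ N, (P n ↔ c)) →
      ((∀ᶠ n in (hyperfilter ℕ : Filter ℕ), P n) ↔ c) := by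
    intro P c N h
    have h' : ∀ᶠ n in (hyperfilter ℕ : Filter ℕ), (P n ↔ c) :=
      Filter.Eventually.filter_mono Nat.hyperfilter_le_atTop (eventually_atTop.2 ⟨N, h⟩)
    rw [eventually_congr h', eventually_const]
  refine ⟨U, (hU _).2 (Eventually.of_forall fun n =>
    eventually_seqUltrafilter_forall hp (by simp [d]) n), fun C hC m R hR => ?_⟩
  obtain ⟨N, hN⟩ := eventually_seqUltrafilter_compSeq d hinv m hC
  rw [hU, hU, hlim _ _ N fun n hn => hN n hn R hR,
    hlim _ _ m fun n hn => eventually_seqUltrafilter_of_le p d hn hR]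

/-! ### A strongly stationary extension with insensitive coordinates -/

theorem map_eq_of_tendsto {Ω Z β : Type*} [MeasurableSpace Ω] [TopologicalSpace Ω]
    [OpensMeasurableSpace Ω] [MeasurableSpace Z] [TopologicalSpace Z] [BorelSpace Z]
    [HasOuterApproxClosed Z] {F : Filter β} [F.NeBot] {G : β → ProbabilityMeasure Ω}
    {ρ : ProbabilityMeasure Ω} (h : Tendsto G F (𝓝 ρ)) {T : Ω → Z} (hT : Continuous T)
    {ν : Measure Z} (hν : ∀ᶠ B in F, (G B : Measure Ω).map T = ν) :
    (ρ : Measure Ω).map T = ν := by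
  have hlim := ((ProbabilityMeasure.continuous_map hT).tendsto ρ).comp h
  obtain ⟨B₀, hB₀⟩ := hν.exists
  have hconst : Tendsto ((fun μ : ProbabilityMeasure Ω => μ.map hT.measurable.aemeasurable) ∘ G) F
      (𝓝 ((G B₀).map hT.measurable.aemeasurable)) := by
    refine tendsto_const_nhds.congr' ?_
    filter_upwards [hν] with B hB
    exact Subtype.ext (hB₀.trans hB.symm)
  have := congrArg (fun μ : ProbabilityMeasure Z => (μ : Measure Z))
    (tendsto_nhds_unique hlim hconst)
  exact this.trans hB₀

/-- The letter `a`, with `i₀` replaced by `l`. -/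
def replLetter {k : ℕ} (i₀ l a : Fin k) : Fin k := if a = i₀ then l else a

/-- The word `l · r(B(w))`, where `r` replaces every letter `i₀` by `l`. -/
def replWord {k : ℕ} (i₀ : Fin k) (B : ℕ → List (Option (Fin k))) (w : Word k) (l : Fin k) :
    Word k :=
  ⟨l :: (substSeq B w.1).map (replLetter i₀ l), List.cons_ne_nil _ _⟩

theorem replWord_subspace {k : ℕ} (i₀ : Fin k) (B : ℕ → List (Option (Fin k)))
    (C : ℕ → VarWord k) (w : Word k) (l : Fin k) :
    replWord i₀ B (subspace C w) l = replWord i₀ (compSeq B fun n => (C n).1) w l := by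
  apply Subtype.ext
  simp only [replWord, subspace, substSeq_compSeq, substList_eq_substSeq]

/-- The `i₀`-th coordinate is a subspace. -/
theorem replWord_self {k : ℕ} (i₀ : Fin k) {B : ℕ → List (Option (Fin k))}
    (hB : ∀ i, none ∈ B i) :
    ∃ C : ℕ → VarWord k, ∀ w, replWord i₀ B w i₀ = subspace C w := by
  refine ⟨fun n => ⟨if n = 0 then some i₀ :: B 0 else B n, ?_⟩, fun w => ?_⟩
  · split_ifs with h
    · exact List.mem_cons_of_mem _ (hB 0)
    · exact hB n
  · apply Subtype.ext
    have hid : replLetter i₀ i₀ = id := by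
      funext a
      by_cases h : a = i₀ <;> simp [replLetter, h]
    obtain ⟨_ | ⟨a, v⟩, hw⟩ := w
    · exact absurd rfl hw
    · simp [replWord, subspace, substList_eq_substSeq, substSeq, hid]

/-- For a fixed word `w`, the words `replWord i₀ B w l` form a combinatorial line. -/
theorem replWord_eq_line {k : ℕ} (i₀ : Fin k) (B : ℕ → List (Option (Fin k))) (w : Word k) :
    ∃ b : VarWord k, ∀ l, replWord i₀ B w l = line b l := by
  refine ⟨⟨none :: (substSeq B w.1).map fun a => if a = i₀ then none else some a,
    List.mem_cons_self⟩, fun l => Subtype.ext ?_⟩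
  simp only [replWord, line, VarWord.subst, List.map_cons, List.map_map, Option.getD_none]
  congr 1
  refine List.map_congr_left fun a _ => ?_
  by_cases h : a = i₀ <;> simp [replLetter, h]

/-- Exchanging the letters `i₀` and `l` in the place of a variable does not change
`replWord i₀ B · l`. -/
theorem replWord_line {k : ℕ} (i₀ : Fin k) (B : ℕ → List (Option (Fin k))) (b : VarWord k)
    (l : Fin k) : replWord i₀ B (line b i₀) l = replWord i₀ B (line b l) l := by
  apply Subtype.ext
  simp only [replWord, line, VarWord.subst]
  congr 1
  have key : ∀ (L : List (Option (Fin k))) (B : ℕ → List (Option (Fin k))),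
      (substSeq B (L.map fun c => c.getD i₀)).map (replLetter i₀ l) =
        (substSeq B (L.map fun c => c.getD l)).map (replLetter i₀ l) := by
    intro L
    induction L with
    | nil => intro B; rfl
    | cons c L ih =>
      intro B
      simp only [List.map_cons, substSeq, List.map_append, ih, List.map_map]
      congr 1
      refine List.map_congr_left fun o _ => ?_
      cases o <;> cases c <;> simp [replLetter]
  exact key _ _

theorem replWord_congr {k : ℕ} (i₀ : Fin k) {B B' : ℕ → List (Option (Fin k))} {w : Word k}
    (h : ∀ i < w.1.length, B i = B' i) (l : Fin k) : replWord i₀ B w l = replWord i₀ B' w l :=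
  Subtype.ext (by simp only [replWord, substSeq_congr h])

set_option synthInstance.maxSize 1000 in
/-- For every letter `i₀` there is a strongly stationary extension on `X^k`, with the `i₀`-th
coordinate as factor map, in which the `l`-th coordinate is `{i₀, l}`-insensitive and whose
point-marginal is the line-marginal of `μ`. It is a limit, over random subspaces `B`, of the laws of
`w ↦ (x_{l · r_l(B(w))})_l`, where `r_l` replaces `i₀` by `l`. -/
theorem exists_insensitive_extension {k : ℕ} [NeZero k] {X : Type u} [MeasurableSpace X]
    [StandardBorelSpace X] (μ : Measure (Word k → X)) [IsProbabilityMeasure μ]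
    (hss : StronglyStationary μ) (i₀ : Fin k) :
    ∃ μ' : Measure (Word k → Fin k → X), IsProbabilityMeasure μ' ∧ StronglyStationary μ' ∧
      μ'.map (fun x w => x w i₀) = μ ∧ pointMarginal μ' = lineMarginal μ ∧
      ∀ (b : VarWord k) (l : Fin k), ∀ᵐ x ∂μ', x (line b i₀) l = x (line b l) l := by
  have hXne : Nonempty X := by
    obtain ⟨x⟩ := nonempty_of_isProbabilityMeasure μ
    exact ⟨x (letter 0)⟩
  -- Realize `X` inside the Cantor space, where limits of laws exist by compactness.
  obtain ⟨ι, hι, hιinj⟩ := MeasurableSpace.measurable_injection_nat_bool_of_countablySeparated X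
  obtain ⟨g, hg, hgι⟩ : ∃ g : (ℕ → Bool) → X, Measurable g ∧ ∀ x, g (ι x) = x := by
    obtain ⟨g, hg, hgι⟩ := (hι.measurableEmbedding hιinj).exists_measurable_extend
      measurable_id fun _ => hXne
    exact ⟨g, hg, congrFun hgι⟩
  obtain ⟨U, hU, hUinv⟩ := exists_seqUltrafilter_invariant (Fin k)
  let D (B : ℕ → List (Option (Fin k))) (x : Word k → X) (w : Word k) (l : Fin k) : ℕ → Bool :=
    ι (x (replWord i₀ B w l))
  have hD : ∀ B, Measurable (D B) := fun B => measurable_pi_lambda _ fun w =>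
    measurable_pi_lambda _ fun l => hι.comp (measurable_pi_apply _)
  let G (B : ℕ → List (Option (Fin k))) : ProbabilityMeasure (Word k → Fin k → ℕ → Bool) :=
    ⟨μ.map (D B), Measure.isProbabilityMeasure_map (hD B).aemeasurable⟩
  have hG : ∀ B, (G B : Measure (Word k → Fin k → ℕ → Bool)) = μ.map (D B) := fun B => rfl
  let ρ : ProbabilityMeasure (Word k → Fin k → ℕ → Bool) := (U.map G).lim
  have hlim : Tendsto G (U : Filter (ℕ → List (Option (Fin k)))) (𝓝 ρ) :=
    Ultrafilter.le_nhds_lim (U.map G)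
  have hres : ∀ C : ℕ → VarWord k,
      Continuous fun (y : Word k → Fin k → ℕ → Bool) w => y (subspace C w) := fun C => by fun_prop
  have hstat : StronglyStationary (ρ : Measure (Word k → Fin k → ℕ → Bool)) := by
    intro C
    have : ∀ J : Finset (Word k), IsProbabilityMeasure
        ((ρ : Measure (Word k → Fin k → ℕ → Bool)).map J.restrict) := fun J =>
      Measure.isProbabilityMeasure_map (by fun_prop)
    refine IsProjectiveLimit.unique
      (P := fun J => (ρ : Measure (Word k → Fin k → ℕ → Bool)).map J.restrict)
      (fun J => ?_) (fun J => rfl)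
    have hJ : Continuous (J.restrict : (Word k → Fin k → ℕ → Bool) → _) := by fun_prop
    let H : (ℕ → List (Option (Fin k))) → ProbabilityMeasure (J → Fin k → ℕ → Bool) :=
      fun B => (G B).map hJ.measurable.aemeasurable
    have h1 : Tendsto H (U : Filter (ℕ → List (Option (Fin k))))
        (𝓝 (ρ.map hJ.measurable.aemeasurable)) :=
      ((ProbabilityMeasure.continuous_map hJ).tendsto ρ).comp hlim
    have h2 : Tendsto (fun B => H (compSeq B fun n => (C n).1))
        (U : Filter (ℕ → List (Option (Fin k))))
        (𝓝 ((ρ.map (hres C).measurable.aemeasurable).map hJ.measurable.aemeasurable)) := by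
      have h3 := ((ProbabilityMeasure.continuous_map hJ).tendsto _).comp
        (((ProbabilityMeasure.continuous_map (hres C)).tendsto ρ).comp hlim)
      refine h3.congr fun B => ?_
      have h4 : (G B).map (hres C).measurable.aemeasurable = G (compSeq B fun n => (C n).1) := by
        apply Subtype.ext
        change (μ.map (D B)).map _ = μ.map (D _)
        rw [Measure.map_map (hres C).measurable (hD B)]
        congr 1
        funext x w l
        exact congrArg (fun w' => ι (x w')) (replWord_subspace i₀ B C w l)
      exact congrArg (fun ν => ProbabilityMeasure.map ν hJ.measurable.aemeasurable) h4
    obtain ⟨m, hm⟩ : ∃ m, ∀ w ∈ J, w.1.length ≤ m :=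
      ⟨J.sup fun w => w.1.length, fun w hw => Finset.le_sup (f := fun w : Word k => w.1.length) hw⟩
    -- A word of length at most `m` meets only the first `m` blocks.
    have hdep : DependsOn H (Set.Iio m) := by
      intro B B' hBB
      apply Subtype.ext
      change (μ.map (D B)).map _ = (μ.map (D B')).map _
      rw [Measure.map_map hJ.measurable (hD B), Measure.map_map hJ.measurable (hD B')]
      congr 1
      funext x w l
      exact congrArg (fun w' => ι (x w'))
        (replWord_congr i₀ (fun i hi => hBB i (hi.trans_le (hm w w.2))) l)
    -- The ultrafilter `U` does not distinguish `B` from its composite with `C` here.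
    have h5 : Tendsto (fun B => H (compSeq B fun n => (C n).1))
        (U : Filter (ℕ → List (Option (Fin k)))) (𝓝 (ρ.map hJ.measurable.aemeasurable)) := by
      intro s hs
      exact (hUinv (fun n => (C n).1) (fun n => (C n).2) m (fun B => H B ∈ s)
        fun B B' h => congrArg (· ∈ s) (hdep h)).2 (h1 hs)
    exact congrArg (fun ν : ProbabilityMeasure (J → Fin k → ℕ → Bool) =>
      (ν : Measure (J → Fin k → ℕ → Bool))) (tendsto_nhds_unique h2 h5)
  have hfactor : (ρ : Measure (Word k → Fin k → ℕ → Bool)).map (fun y w => y w i₀) =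
      μ.map fun x w => ι (x w) := by
    refine map_eq_of_tendsto hlim (by fun_prop) (hU.mono fun B hB => ?_)
    obtain ⟨C, hC⟩ := replWord_self i₀ hB
    rw [hG, Measure.map_map (by fun_prop) (hD B)]
    have hm : Measurable fun (x : Word k → X) w => ι (x w) := by fun_prop
    conv_rhs => rw [← hss C, Measure.map_map hm (measurable_reindex _)]
    congr 1
    funext x w
    exact congrArg (fun w' => ι (x w')) (hC w)
  have hpoint : (ρ : Measure (Word k → Fin k → ℕ → Bool)).map (fun y => y (letter 0)) =
      (lineMarginal μ).map fun x l => ι (x l) := by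
    refine map_eq_of_tendsto hlim (by fun_prop) (Eventually.of_forall fun B => ?_)
    obtain ⟨b, hb⟩ := replWord_eq_line i₀ B (letter 0)
    have hm : Measurable fun (x : Fin k → X) l => ι (x l) := by fun_prop
    rw [hG, Measure.map_map (by fun_prop) (hD B), ← map_line_eq_lineMarginal hss b,
      Measure.map_map hm (measurable_reindex _)]
    congr 1
    funext x l
    exact congrArg (fun w' => ι (x w')) (hb l)
  have hdiag : ∀ (b : VarWord k) (l : Fin k), ∀ᵐ y ∂(ρ : Measure (Word k → Fin k → ℕ → Bool)),
      y (line b i₀) l = y (line b l) l := by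
    intro b l
    have h := map_eq_of_tendsto hlim
      (T := fun y : Word k → Fin k → ℕ → Bool => (y (line b i₀) l, y (line b l) l))
      (ν := (pointMarginal μ).map fun x => (ι x, ι x)) (by fun_prop)
      (Eventually.of_forall fun B => by
        have hm : Measurable fun x => (ι x, ι x) := by fun_prop
        rw [hG, Measure.map_map (by fun_prop) (hD B),
          ← map_eval_eq_pointMarginal hss (replWord i₀ B (line b i₀) l),
          Measure.map_map hm (measurable_pi_apply _)]
        congr 1
        funext x
        refine Prod.ext rfl ?_
        exact congrArg (fun w' => ι (x w')) (replWord_line i₀ B b l).symm)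
    have hmeas : MeasurableSet {z : (ℕ → Bool) × (ℕ → Bool) | z.1 = z.2} :=
      measurableSet_eq_fun measurable_fst measurable_snd
    have h6 : ∀ᵐ z ∂(pointMarginal μ).map (fun x => (ι x, ι x)), z.1 = z.2 :=
      (ae_map_iff (by fun_prop) hmeas).2 (Eventually.of_forall fun x => rfl)
    rw [← h] at h6
    exact ae_of_ae_map (by fun_prop) h6
  -- Transport the limit from the Cantor space back to `X`.
  have hgm : Measurable fun (y : Word k → Fin k → ℕ → Bool) w l => g (y w l) := by fun_prop
  refine ⟨(ρ : Measure (Word k → Fin k → ℕ → Bool)).map fun y w l => g (y w l),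
    Measure.isProbabilityMeasure_map hgm.aemeasurable, fun C => ?_, ?_, ?_, fun b l => ?_⟩
  · conv_rhs => rw [← hstat C, Measure.map_map hgm (measurable_reindex _)]
    rw [Measure.map_map (measurable_reindex _) hgm]
    rfl
  · have hm : Measurable fun (y : Word k → ℕ → Bool) w => g (y w) := by fun_prop
    have h := congrArg (fun ν => ν.map fun (y : Word k → ℕ → Bool) w => g (y w)) hfactor
    rw [Measure.map_map hm (by fun_prop), Measure.map_map hm (by fun_prop)] at h
    rw [Measure.map_map (by fun_prop) hgm]
    refine h.trans ?_
    simp only [Function.comp_def, hgι]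
    exact Measure.map_id
  · have hm : Measurable fun (y : Fin k → ℕ → Bool) l => g (y l) := by fun_prop
    have h := congrArg (fun ν => ν.map fun (y : Fin k → ℕ → Bool) l => g (y l)) hpoint
    rw [Measure.map_map hm (by fun_prop), Measure.map_map hm (by fun_prop)] at h
    rw [pointMarginal, Measure.map_map (by fun_prop) hgm]
    refine h.trans ?_
    simp only [Function.comp_def, hgι]
    exact Measure.map_id
  · have hmeas : MeasurableSet {x : Word k → Fin k → X | x (line b i₀) l = x (line b l) l} :=
      measurableSet_eq_fun (by fun_prop) (by fun_prop)
    exact (ae_map_iff hgm.aemeasurable hmeas).2 ((hdiag b l).mono fun y hy => congrArg g hy)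

/-! ### Conditional independence and integrals of products -/

theorem integral_condExp_smul {Ω E : Type*} {m mΩ : MeasurableSpace Ω} {ν : Measure Ω}
    [IsFiniteMeasure ν] [NormedAddCommGroup E] [NormedSpace ℝ E] [CompleteSpace E] (hm : m ≤ mΩ)
    {c : Ω → ℝ} (hc : MemLp c ⊤ ν) {g : Ω → E} (hg : Integrable g ν) :
    ∫ x, (ν[c | m]) x • g x ∂ν = ∫ x, c x • (ν[g | m]) x ∂ν := by
  have hc' : MemLp (ν[c | m]) ⊤ ν := hc.condExp le_top
  have hci : Integrable c ν := hc.integrable le_top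
  have h1 := condExp_smul_of_aestronglyMeasurable_left (μ := ν) (m := m) (f := ν[c | m]) (g := g)
    stronglyMeasurable_condExp.aestronglyMeasurable (hg.smul_of_top_right hc') hg
  have h2 := condExp_smul_of_aestronglyMeasurable_right (μ := ν) (m := m) (f := c) (g := ν[g | m])
    hci (integrable_condExp.smul_of_top_right hc) stronglyMeasurable_condExp.aestronglyMeasurable
  calc ∫ x, (ν[c | m]) x • g x ∂ν = ∫ x, (ν[ν[c | m] • g | m]) x ∂ν :=
        (integral_condExp (f := ν[c | m] • g) hm).symm
    _ = ∫ x, (ν[c • ν[g | m] | m]) x ∂ν := integral_congr_ae (h1.trans h2.symm)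
    _ = _ := integral_condExp (f := c • ν[g | m]) hm

theorem condExp_indicator_eq_of_condIndep {Ω : Type*} {m' m₁ m₂ mΩ : MeasurableSpace Ω}
    [StandardBorelSpace Ω] {ν : Measure Ω} [IsFiniteMeasure ν] (hm' : m' ≤ mΩ) (h₁ : m₁ ≤ mΩ)
    (h₂ : m₂ ≤ mΩ) (hle : m' ≤ m₁) (h : CondIndep m' m₁ m₂ hm' ν) {t : Set Ω}
    (ht : MeasurableSet[m₂] t) : ν⟦t | m'⟧ =ᵐ[ν] ν⟦t | m₁⟧ := by
  have hind : ∀ s : Set Ω, MeasurableSet[mΩ] s → MemLp (s.indicator fun _ => (1 : ℝ)) ⊤ ν :=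
    fun s hs => (memLp_const _).indicator hs
  have hcl : ∀ s : Set Ω, MeasurableSet[mΩ] s → Integrable (s.indicator fun _ => (1 : ℝ)) ν :=
    fun s hs => (hind s hs).integrable le_top
  refine ae_eq_condExp_of_forall_setIntegral_eq h₁ (hcl t (h₂ t ht))
    (fun s _ _ => integrable_condExp.integrableOn) (fun s hs _ => ?_)
    (stronglyMeasurable_condExp.mono hle).aestronglyMeasurable
  have hsm := h₁ s hs
  have hprod := (condIndep_iff m' m₁ m₂ hm' h₁ h₂ ν).1 h s t hs ht
  have hmul : ∀ f : Ω → ℝ, ∫ x in s, f x ∂ν = ∫ x, (s.indicator fun _ => (1 : ℝ)) x • f x ∂ν := by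
    intro f
    rw [← integral_indicator hsm]
    refine integral_congr_ae (Eventually.of_forall fun x => ?_)
    by_cases hx : x ∈ s <;> simp [hx]
  have hidem : ν[ν⟦t | m'⟧ | m'] = ν⟦t | m'⟧ :=
    condExp_of_stronglyMeasurable hm' stronglyMeasurable_condExp integrable_condExp
  calc ∫ x in s, (ν⟦t | m'⟧) x ∂ν
      = ∫ x, (s.indicator fun _ => (1 : ℝ)) x • (ν[ν⟦t | m'⟧ | m']) x ∂ν := by
        rw [hmul, hidem]
    _ = ∫ x, (ν⟦s | m'⟧) x • (ν⟦t | m'⟧) x ∂ν :=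
        (integral_condExp_smul hm' (hind s hsm) integrable_condExp).symm
    _ = ∫ x, (ν⟦s ∩ t | m'⟧) x ∂ν := integral_congr_ae hprod.symm
    _ = ∫ x, ((s ∩ t).indicator fun _ => (1 : ℝ)) x ∂ν := integral_condExp hm'
    _ = ∫ x in s, (t.indicator fun _ => (1 : ℝ)) x ∂ν := by
        rw [hmul]
        refine integral_congr_ae (Eventually.of_forall fun x => ?_)
        by_cases hx : x ∈ s <;> by_cases hx' : x ∈ t <;> simp [hx, hx']

/-- If `m₁` and `m₂` are independent over `m' ≤ m₁`, an `m₁`-measurable factor `F` can be replaced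
by its conditional expectation on `m'` in an integral against an `m₂`-measurable `h`. -/
theorem integral_mul_eq_of_condIndep {𝕜 Ω : Type*} [RCLike 𝕜] {m' m₁ m₂ mΩ : MeasurableSpace Ω}
    [StandardBorelSpace Ω] {ν : Measure Ω} [IsFiniteMeasure ν] (hm' : m' ≤ mΩ) (h₁ : m₁ ≤ mΩ)
    (h₂ : m₂ ≤ mΩ) (hle : m' ≤ m₁) (hci : CondIndep m' m₁ m₂ hm' ν) {F h : Ω → 𝕜}
    (hF : Integrable F ν) (hFm : AEStronglyMeasurable[m₁] F ν) (hh : MemLp h ⊤ ν)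
    (hhm : AEStronglyMeasurable[m₂] h ν) :
    ∫ x, F x * h x ∂ν = ∫ x, (ν[F | m']) x * h x ∂ν := by
  have hF₁ : ν[F | m₁] =ᵐ[ν] F := condExp_of_aestronglyMeasurable' h₁ hFm hF
  have hset : ∀ t, MeasurableSet[m₂] t → ∫ x in t, F x ∂ν = ∫ x in t, (ν[F | m']) x ∂ν := by
    intro t ht
    have htm := h₂ t ht
    have hind : MemLp (t.indicator fun _ => (1 : ℝ)) ⊤ ν := (memLp_const _).indicator htm
    have hmul : ∀ f : Ω → 𝕜,
        ∫ x in t, f x ∂ν = ∫ x, (t.indicator fun _ => (1 : ℝ)) x • f x ∂ν := by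
      intro f
      rw [← integral_indicator htm]
      refine integral_congr_ae (Eventually.of_forall fun x => ?_)
      by_cases hx : x ∈ t <;> simp [hx]
    rw [hmul, hmul, ← integral_condExp_smul hm' hind hF]
    calc _ = ∫ x, (t.indicator fun _ => (1 : ℝ)) x • (ν[F | m₁]) x ∂ν :=
          integral_congr_ae (hF₁.mono fun x hx => by simp only [hx])
      _ = ∫ x, (ν⟦t | m₁⟧) x • F x ∂ν := (integral_condExp_smul h₁ hind hF).symm
      _ = _ := integral_congr_ae ((condExp_indicator_eq_of_condIndep hm' h₁ h₂ hle hci ht).mono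
          fun x hx => by simp only [hx])
  have hcond : ν[ν[F | m'] | m₂] =ᵐ[ν] ν[F | m₂] :=
    ae_eq_condExp_of_forall_setIntegral_eq h₂ hF (fun s _ _ => integrable_condExp.integrableOn)
      (fun s hs _ => by rw [setIntegral_condExp h₂ integrable_condExp hs, hset s hs])
      stronglyMeasurable_condExp.aestronglyMeasurable
  have hpull : ∀ f : Ω → 𝕜, Integrable f ν →
      ∫ x, f x * h x ∂ν = ∫ x, (ν[f | m₂]) x * h x ∂ν := by
    intro f hf
    rw [← integral_condExp h₂]
    exact integral_congr_ae (condExp_bilin_of_aestronglyMeasurable_right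
      (ContinuousLinearMap.mul ℝ 𝕜) hhm (hf.mul_of_top_left hh) hf)
  exact (hpull F hF).trans ((integral_congr_ae (hcond.mono fun x hx => by simp only [hx])).trans
    (hpull _ integrable_condExp).symm)

/-- Conditional expectations commute with pulling back along a factor map. -/
theorem condExp_comp_comap {Ω X E : Type*} {mΩ : MeasurableSpace Ω} {m mX : MeasurableSpace X}
    [NormedAddCommGroup E] [NormedSpace ℝ E] [CompleteSpace E] {ν : Measure Ω} [IsFiniteMeasure ν]
    {π : Ω → X} (hπ : Measurable π) (hm : m ≤ mX) {f : X → E} (hf : Integrable f (ν.map π)) :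
    (fun y => ((ν.map π)[f | m]) (π y)) =ᵐ[ν] ν[fun y => f (π y) | m.comap π] := by
  have hle : m.comap π ≤ mΩ := (MeasurableSpace.comap_mono hm).trans hπ.comap_le
  have hint : ∀ {g : X → E}, Integrable g (ν.map π) → Integrable (fun y => g (π y)) ν :=
    fun hg => hg.comp_measurable hπ
  refine ae_eq_condExp_of_forall_setIntegral_eq hle (hint hf)
    (fun s _ _ => (hint integrable_condExp).integrableOn) ?_
    (stronglyMeasurable_condExp.comp_measurable (comap_measurable π)).aestronglyMeasurable
  rintro _ ⟨s, hs, rfl⟩ _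
  have hmap : ∀ {g : X → E}, Integrable g (ν.map π) →
      ∫ y in π ⁻¹' s, g (π y) ∂ν = ∫ x in s, g x ∂(ν.map π) :=
    fun hg => (setIntegral_map (hm s hs) hg.aestronglyMeasurable hπ.aemeasurable).symm
  rw [hmap hf, hmap integrable_condExp, setIntegral_condExp hm hf hs]

/-! ### Replacing the factors by conditional expectations -/

theorem lineMarginal_map_eval {k : ℕ} [NeZero k] {X : Type u} [MeasurableSpace X]
    {μ : Measure (Word k → X)} (hss : StronglyStationary μ) (i : Fin k) :
    (lineMarginal μ).map (fun y => y i) = pointMarginal μ := by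
  rw [lineMarginal, Measure.map_map (measurable_pi_apply i) (measurable_reindex _)]
  exact map_eval_eq_pointMarginal hss (letter i)

theorem insensJoin_pairs_eq {k : ℕ} {X : Type u} [MeasurableSpace X] (μ : Measure (Word k → X))
    (e : Finset (Fin k)) (i : Fin k) :
    insensJoin μ {u | ∃ l ∈ e.erase i, {i, l} ⊆ u} = ⨆ l ∈ e.erase i, insens μ {i, l} := by
  refine le_antisymm (iSup₂_le ?_) (iSup₂_le fun l hl => ?_)
  · rintro u ⟨l, hl, hu⟩
    have hle : insens μ u ≤ insens μ {i, l} := by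
      intro A hA
      refine ⟨hA.1, fun b => ?_⟩
      filter_upwards [hA.2 b] with x hx a ha c hc
      exact hx a (hu ha) c (hu hc)
    exact hle.trans (le_iSup₂ (f := fun l (_ : l ∈ e.erase i) => insens μ {i, l}) l hl)
  · exact le_iSup₂ (f := fun u (_ : u ∈ {u | ∃ l ∈ e.erase i, {i, l} ⊆ u}) => insens μ u)
      {i, l} ⟨l, hl, subset_rfl⟩

theorem isUpSet_pairs {k : ℕ} (e : Finset (Fin k)) (i : Fin k) :
    IsUpSet {u | ∃ l ∈ e.erase i, {i, l} ⊆ u} where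
  two_le_card := by
    rintro u ⟨l, hl, hu⟩
    rw [← Finset.card_pair (Finset.ne_of_mem_erase hl).symm]
    exact Finset.card_le_card hu
  mem_of_subset := by
    rintro u ⟨l, hl, hu⟩ u' huu'
    exact ⟨l, hl, hu.trans huu'⟩

theorem memLp_top_finsetProd {𝕜 Ω ι : Type*} [RCLike 𝕜] [MeasurableSpace Ω] {ν : Measure Ω}
    [IsFiniteMeasure ν] (s : Finset ι) {f : ι → Ω → 𝕜} (hf : ∀ i ∈ s, MemLp (f i) ⊤ ν) :
    MemLp (fun x => ∏ i ∈ s, f i x) ⊤ ν := by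
  simpa using MemLp.prod' hf

/-- One factor of the product can be replaced by its conditional expectation. In the extension
`exists_insensitive_extension` the other factors are measurable for the insensitive σ-algebra, over
which satedness makes the `i`-th factor relatively independent. -/
theorem integral_prod_eq_condExp_mul {𝕜 : Type*} [RCLike 𝕜] {k : ℕ} [NeZero k]
    {X : Type u} [MeasurableSpace X] [StandardBorelSpace X]
    (μ : Measure (Word k → X)) [IsProbabilityMeasure μ]
    (hss : StronglyStationary μ) (hsated : FullySated μ) {e : Finset (Fin k)} {i : Fin k}
    (hi : i ∈ e) {f : Fin k → X → 𝕜} (hf : ∀ j ∈ e, MemLp (f j) ⊤ (pointMarginal μ)) :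
    ∫ y, ∏ j ∈ e, f j (y j) ∂(lineMarginal μ) =
      ∫ y, ((pointMarginal μ)[f i | ⨆ l ∈ e.erase i, insens μ {i, l}]) (y i) *
        ∏ j ∈ e.erase i, f j (y j) ∂(lineMarginal μ) := by
  simp only [← Finset.mul_prod_erase e _ hi]
  have hfi : Integrable (f i) (pointMarginal μ) := (hf i hi).integrable le_top
  obtain hempty | hne := (e.erase i).eq_empty_or_nonempty
  -- For `e = {i}` the join is trivial, and only the integral of `f i` matters.
  · have hmap : ∀ {g : X → 𝕜}, AEStronglyMeasurable g (pointMarginal μ) →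
        ∫ y, g (y i) ∂(lineMarginal μ) = ∫ x, g x ∂(pointMarginal μ) := by
      intro g hg
      rw [← lineMarginal_map_eval hss i] at hg ⊢
      exact (integral_map (measurable_pi_apply i).aemeasurable hg).symm
    simp only [hempty, Finset.prod_empty, mul_one]
    rw [hmap hfi.aestronglyMeasurable, hmap integrable_condExp.aestronglyMeasurable,
      integral_condExp (iSup₂_le fun l _ => insens_le μ {i, l})]
  obtain ⟨μ', hμ', hss', hfac, hpoint, hdiag⟩ := exists_insensitive_extension μ hss i
  set I : Set (Finset (Fin k)) := {u | ∃ l ∈ e.erase i, {i, l} ⊆ u}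
  have hIne : I.Nonempty := by
    obtain ⟨l, hl⟩ := hne
    exact ⟨{i, l}, l, hl, subset_rfl⟩
  have hπ : Measurable fun y : Fin k → X => y i := measurable_pi_apply i
  have hcond := hsated I (isUpSet_pairs e i) hIne (Fin k → X) μ' hss' (fun y => y i) hπ hfac
  have hmarg : ∀ j, (pointMarginal μ').map (fun y : Fin k → X => y j) = pointMarginal μ :=
    fun j => by rw [hpoint, lineMarginal_map_eval hss j]
  have hLp : ∀ j ∈ e, MemLp (fun y : Fin k → X => f j (y j)) ⊤ (pointMarginal μ') := fun j hj =>
    (by rw [hmarg j]; exact hf j hj :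
      MemLp (f j) ⊤ ((pointMarginal μ').map fun y => y j)).comp_of_map
        (measurable_pi_apply j).aemeasurable
  have hins : ∀ j ∈ e.erase i, Measurable[insensJoin μ' I] fun y : Fin k → X => y j := by
    intro j hj A hA
    refine le_iSup₂ (f := fun u (_ : u ∈ I) => insens μ' u) {i, j} ⟨j, hj, subset_rfl⟩ _
      ⟨measurable_pi_apply j hA, fun b => ?_⟩
    filter_upwards [hdiag b j] with x hx
    have hx' : ∀ a ∈ ({i, j} : Finset (Fin k)), x (line b a) j = x (line b j) j := by
      intro a ha
      rcases Finset.mem_insert.1 ha with rfl | ha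
      · exact hx
      · rw [Finset.mem_singleton.1 ha]
    intro a ha c hc
    simp only [Set.mem_preimage, hx' a ha, hx' c hc]
  have hmeas : AEStronglyMeasurable[insensJoin μ' I]
      (fun y : Fin k → X => ∏ j ∈ e.erase i, f j (y j)) (pointMarginal μ') := by
    have hf' : ∀ j : (e.erase i : Finset (Fin k)), ∃ f' : X → 𝕜, StronglyMeasurable f' ∧
        (fun y : Fin k → X => f j (y j)) =ᵐ[pointMarginal μ'] fun y => f' (y j) := fun j => by
      obtain ⟨f', hf', hae⟩ := (hf j (Finset.mem_of_mem_erase j.2)).1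
      rw [← hmarg j] at hae
      exact ⟨f', hf', ae_of_ae_map (measurable_pi_apply _).aemeasurable hae⟩
    choose f' hf' hae using hf'
    refine ⟨fun y => ∏ j ∈ (e.erase i).attach, f' j (y j), ?_, ?_⟩
    · exact Finset.stronglyMeasurable_fun_prod _ fun j _ => (hf' j).comp_measurable (hins j j.2)
    · filter_upwards [ae_all_iff.2 hae] with y hy
      rw [← Finset.prod_attach]
      exact Finset.prod_congr rfl fun j _ => hy j
  have hFi := hfi
  rw [← hmarg i] at hFi
  rw [← hpoint, integral_mul_eq_of_condIndep _ hπ.comap_le (insensJoin_le μ' I)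
    (MeasurableSpace.comap_mono (insensJoin_le μ I)) hcond ((hLp i hi).integrable le_top) ?_
    (memLp_top_finsetProd _ fun j hj => hLp j (Finset.mem_of_mem_erase hj)) hmeas,
    ← insensJoin_pairs_eq]
  · refine integral_congr_ae ?_
    filter_upwards [condExp_comp_comap hπ (insensJoin_le μ I) hFi] with y hy
    rw [hmarg i] at hy
    rw [hy]
  · obtain ⟨f', hf', hae⟩ := hFi.aestronglyMeasurable
    exact ⟨fun y => f' (y i), hf'.comp_measurable (comap_measurable _),
      ae_of_ae_map hπ.aemeasurable hae⟩

end CombLaw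

theorem theorem6p2 {𝕜 : Type*} [RCLike 𝕜] {k : ℕ} [NeZero k]
    {X : Type u} [MeasurableSpace X] [StandardBorelSpace X]
    (μ : Measure (CombLaw.Word k → X)) [IsProbabilityMeasure μ]
    (hss : CombLaw.StronglyStationary μ) (hsated : CombLaw.FullySated μ)
    (e : Finset (Fin k)) (he : e.Nonempty)
    (f : Fin k → X → 𝕜) (hf : ∀ i ∈ e, MemLp (f i) ⊤ (CombLaw.pointMarginal μ)) :
    ∫ y, ∏ i ∈ e, f i (y i) ∂(CombLaw.lineMarginal μ) =
      ∫ y, ∏ i ∈ e,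
        ((CombLaw.pointMarginal μ)[f i | ⨆ l ∈ e.erase i, CombLaw.insens μ {i, l}]) (y i)
          ∂(CombLaw.lineMarginal μ) := by
  classical
  set P : Fin k → X → 𝕜 := fun i =>
    (CombLaw.pointMarginal μ)[f i | ⨆ l ∈ e.erase i, CombLaw.insens μ {i, l}]
  have key : ∀ s ⊆ e, ∫ y, ∏ i ∈ e, f i (y i) ∂(CombLaw.lineMarginal μ) =
      ∫ y, ∏ i ∈ e, (if i ∈ s then P i else f i) (y i) ∂(CombLaw.lineMarginal μ) := by
    intro s
    induction s using Finset.induction_on with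
    | empty => simp
    | insert i s his ih =>
      intro hs
      have hi : i ∈ e := hs (Finset.mem_insert_self i s)
      rw [ih ((Finset.subset_insert i s).trans hs),
        CombLaw.integral_prod_eq_condExp_mul μ hss hsated hi (fun j hj => ?_)]
      · congr 1
        funext y
        rw [← Finset.mul_prod_erase e _ hi]
        simp only [his, if_false, Finset.mem_insert_self, if_true]
        congr 1
        refine Finset.prod_congr rfl fun j hj => ?_
        simp [Finset.ne_of_mem_erase hj]
      · split_ifs
        · exact (hf j hj).condExp le_top
        · exact hf j hj
  rw [key e subset_rfl]
  congr 1
  funext y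
  exact Finset.prod_congr rfl fun i hi => by rw [if_pos hi]
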